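/- Let $\mathbb{D}$ be the open unit disk. A one-parameter semigroup is a family $(F_t)_{t\ge 0}$ of holomorphic self-mappings of $\mathbb{D}$ with $F_{s+t}=F_s\circ F_t$ and $F_0=\mathrm{id}$; a holomorphic function $f$ on $\mathbb{D}$ is its generator if $f(z)=\lim_{t\to 0^+}\frac1t\,(z-F_t(z))$ for all $z\in\mathbb{D}$, and $a\in\overline{\mathbb{D}}$ is its Denjoy–Wolff point if $F_t(z)\to a$ as $t\to\infty$ for all $z\in\mathbb{D}$. For $\zeta\in\partial\mathbb{D}$, $\angle\lim_{z\to\zeta}$ denotes the angular (nontangential) limit. If $f$ has a finite angular limit $f(\zeta):=\angle\lim_{z\to\zeta}f(z)$ and $f'(\zeta):=\angle\lim_{z\to\zeta}\frac{f(z)-f(\zeta)}{z-\zeta}$ exists and is finite, then $f'(\zeta)$ is called the angular derivative of $f$ at $\zeta$; if moreover $f(\zeta)=0$, then $\zeta$ is called a boundary regular null point of $f$. **Corollary 4.2.** Let $f$ be the generator of a semigroup of holomorphic self-mappings of $\mathbb{D}$ with Denjoy–Wolff point $1$, and let $\zeta_1,\dots,\zeta_N\in\partial\mathbb{D}$ be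 pairwise distinct boundary regular null points of $f$ different from $1$. Then each $f'(\zeta_n)$ is a negative real number, $f$ has no zeros in $\mathbb{D}$, and $$\sum_{n=1}^N\frac{1-\operatorname{Re}\zeta_n}{|f'(\zeta_n)|}\le-\operatorname{Re}\Big(\frac1{f(0)}\Big).$$ Equality holds if and only if there is $c\in\mathbb{R}$ such that for all $z\in\mathbb{D}$ $$\frac1{f(z)}=\sum_{n=1}^N\frac1{|f'(\zeta_n)|}\Big(\frac1{z-1}-\frac1{z-\zeta_n}\Big)+\frac{ic}{(z-1)^2}.$$ -/

import Mathlib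

open Filter Topology

/-- A one-parameter semigroup `(F t)`, `t ≥ 0`, of holomorphic self-mappings of the open unit
disk. Only the values `F t z` with `0 ≤ t` and `‖z‖ < 1` matter. -/
structure IsDiskSemigroup (F : ℝ → ℂ → ℂ) : Prop where
  holomorphic : ∀ t : ℝ, 0 ≤ t → DifferentiableOn ℂ (F t) (Metric.ball 0 1)
  mapsTo : ∀ t : ℝ, 0 ≤ t → Set.MapsTo (F t) (Metric.ball 0 1) (Metric.ball 0 1)
  add : ∀ s t : ℝ, 0 ≤ s → 0 ≤ t → ∀ z ∈ Metric.ball (0 : ℂ) 1, F (s + t) z = F s (F t z)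
  zero : ∀ z ∈ Metric.ball (0 : ℂ) 1, F 0 z = z

/-- `f` is the (infinitesimal) generator of the family `F`: it is holomorphic in the disk and
`f z = lim_{t → 0+} (z - F t z) / t` for every `z` in the disk. -/
def IsInfinitesimalGenerator (f : ℂ → ℂ) (F : ℝ → ℂ → ℂ) : Prop :=
  DifferentiableOn ℂ f (Metric.ball 0 1) ∧
    ∀ z ∈ Metric.ball (0 : ℂ) 1,
      Tendsto (fun t : ℝ => (z - F t z) / (t : ℂ)) (𝓝[>] 0) (𝓝 (f z))

/-- `a` is the Denjoy-Wolff point of the family `F`: a point of the closed disk to which all the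
orbits converge. (The convergence excludes the trivial semigroup and elliptic automorphisms.) -/
def IsDenjoyWolffPoint (F : ℝ → ℂ → ℂ) (a : ℂ) : Prop :=
  a ∈ Metric.closedBall (0 : ℂ) 1 ∧
    ∀ z ∈ Metric.ball (0 : ℂ) 1, Tendsto (fun t : ℝ => F t z) atTop (𝓝 a)

/-- `f` is the generator of a semigroup of holomorphic self-mappings of the disk whose
Denjoy-Wolff point is `a`. -/
def IsGeneratorWithDenjoyWolffPoint (f : ℂ → ℂ) (a : ℂ) : Prop :=
  ∃ F : ℝ → ℂ → ℂ,
    IsDiskSemigroup F ∧ IsInfinitesimalGenerator f F ∧ IsDenjoyWolffPoint F a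

/-- The nontangential approach region `{z : ‖z‖ < 1, ‖z - ζ‖ < M (1 - ‖z‖)}` at a point `ζ` of the
unit circle. -/
def stolzRegion (ζ : ℂ) (M : ℝ) : Set ℂ :=
  {z : ℂ | ‖z‖ < 1 ∧ ‖z - ζ‖ < M * (1 - ‖z‖)}

/-- `h` has the finite angular (nontangential) limit `L` at the point `ζ` of the unit circle. -/
def HasAngularLimit (h : ℂ → ℂ) (ζ L : ℂ) : Prop :=
  ∀ M : ℝ, 1 < M → Tendsto h (𝓝[stolzRegion ζ M] ζ) (𝓝 L)

/-- `f` has the finite angular derivative `m` at the point `ζ` of the unit circle: with `w` the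
finite angular limit of `f` at `ζ`, the quotient `(f z - w) / (z - ζ)` has angular limit `m`. -/
def HasAngularDeriv (f : ℂ → ℂ) (ζ m : ℂ) : Prop :=
  ∃ w : ℂ, HasAngularLimit f ζ w ∧ HasAngularLimit (fun z => (f z - w) / (z - ζ)) ζ m

/-- `ζ` is a boundary regular null point of `f`. -/
def IsBoundaryRegularNullPoint (f : ℂ → ℂ) (ζ : ℂ) : Prop :=
  ‖ζ‖ = 1 ∧ HasAngularLimit f ζ 0 ∧ ∃ m : ℂ, HasAngularDeriv f ζ m

open Metric Set ComplexConjugate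

/-! Everything is read off from `q z = -(1 - z)^2 / f z`. Horocycles at the Denjoy–Wolff point are
not expanded by the semigroup, and differentiating this at `t = 0` gives `0 ≤ re q`
(`berkson_porta_re_nonneg`). A zero of `f` would be a fixed point, so `q` is holomorphic. In
Herglotz terms, a boundary regular null point `ζ` is an atom of the measure of `q`: `(1 - conj ζ *
z) * q z` has angular limit `2 (1 - re ζ) / ‖m‖`, where `m` is the angular derivative
(`angular_deriv_neg`). No measure is needed: Julia's lemma permits subtracting the Herglotz kernels
of the atoms one by one while the real part stays nonnegative (`re_sub_sum_nonneg`). At the origin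
the remainder `g` gives the inequality. Equality means `re (g 0) = 0`, so `g` is an imaginary
constant, and partial fractions turn this into the stated formula. -/

/-! ### Schwarz–Pick inequalities in the disk and the half-plane -/

theorem normSq_one_sub_conj_mul (a z : ℂ) :
    ‖1 - conj a * z‖ ^ 2 = ‖z - a‖ ^ 2 + (1 - ‖a‖ ^ 2) * (1 - ‖z‖ ^ 2) := by
  simp only [← Complex.normSq_eq_norm_sq, Complex.normSq_apply]
  simp
  ring

theorem normSq_add_conj (a b : ℂ) :
    ‖a + conj b‖ ^ 2 = ‖a - b‖ ^ 2 + 4 * (a.re * b.re) := by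
  simp only [← Complex.normSq_eq_norm_sq, Complex.normSq_apply]
  simp
  ring

theorem one_sub_conj_mul_ne_zero {a z : ℂ} (ha : ‖a‖ ≤ 1) (hz : ‖z‖ < 1) : 1 - conj a * z ≠ 0 := by
  intro h
  have h1 : ‖conj a * z‖ = 1 := by rw [← sub_eq_zero.mp h]; simp
  rw [norm_mul, Complex.norm_conj] at h1
  nlinarith [norm_nonneg a, norm_nonneg z]

theorem norm_moebius_lt_one {a z : ℂ} (ha : ‖a‖ < 1) (hz : ‖z‖ < 1) :
    ‖(z - a) / (1 - conj a * z)‖ < 1 := by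
  have h0 := norm_pos_iff.mpr (one_sub_conj_mul_ne_zero ha.le hz)
  rw [norm_div, div_lt_one h0]
  refine lt_of_pow_lt_pow_left₀ 2 h0.le ?_
  rw [normSq_one_sub_conj_mul]
  have : 0 < (1 - ‖a‖ ^ 2) * (1 - ‖z‖ ^ 2) := by
    apply mul_pos <;> nlinarith [norm_nonneg a, norm_nonneg z]
  linarith

/-- The **Schwarz-Pick lemma** for holomorphic self-maps of the unit disk. -/
theorem schwarz_pick_disk {F : ℂ → ℂ} (hF : DifferentiableOn ℂ F (ball 0 1))
    (hmaps : MapsTo F (ball 0 1) (ball 0 1)) {z w : ℂ} (hz : ‖z‖ < 1) (hw : ‖w‖ < 1) :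
    ‖F z - F w‖ * ‖1 - conj w * z‖ ≤ ‖z - w‖ * ‖1 - conj (F w) * F z‖ := by
  have hmem : ∀ {u : ℂ}, ‖u‖ < 1 → ‖F u‖ < 1 := fun {u} hu => by
    simpa using hmaps (mem_ball_zero_iff.mpr hu)
  have hw' : ‖-w‖ < 1 := by simpa using hw
  -- `φ` sends `0` to `w`; following `F` by the Möbius map that sends `F w` to `0` reduces the claim
  -- to the Schwarz lemma at the `φ`-preimage of `z`.
  set φ : ℂ → ℂ := fun u => (u - -w) / (1 - conj (-w) * u) with hφ
  have hφmaps : MapsTo φ (ball 0 1) (ball 0 1) := fun u hu =>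
    mem_ball_zero_iff.mpr (norm_moebius_lt_one hw' (mem_ball_zero_iff.mp hu))
  set g : ℂ → ℂ := fun u => (F (φ u) - F w) / (1 - conj (F w) * F (φ u)) with hg
  have hφd : DifferentiableOn ℂ φ (ball 0 1) := by
    apply DifferentiableOn.div (by fun_prop) (by fun_prop)
    intro u hu
    exact one_sub_conj_mul_ne_zero hw'.le (mem_ball_zero_iff.mp hu)
  have hFφ : DifferentiableOn ℂ (fun u => F (φ u)) (ball 0 1) := hF.comp hφd hφmaps
  have hgd : DifferentiableOn ℂ g (ball 0 1) := by
    apply DifferentiableOn.div (by fun_prop) (by fun_prop)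
    intro u hu
    exact one_sub_conj_mul_ne_zero (hmem hw).le (hmem (mem_ball_zero_iff.mp (hφmaps hu)))
  have hgmaps : MapsTo g (ball 0 1) (closedBall 0 1) := fun u hu =>
    mem_closedBall_zero_iff.mpr
      (norm_moebius_lt_one (hmem hw) (hmem (mem_ball_zero_iff.mp (hφmaps hu)))).le
  have hg0 : g 0 = 0 := by simp [hg, hφ]
  have key := Complex.norm_le_norm_of_mapsTo_ball hgd hgmaps hg0 (norm_moebius_lt_one hw hz)
  have hne := one_sub_conj_mul_ne_zero hw.le hz
  have hww : 1 - conj w * w ≠ 0 := one_sub_conj_mul_ne_zero hw.le hw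
  have hφz : φ ((z - w) / (1 - conj w * z)) = z := by
    have h1 : 1 - conj (-w) * ((z - w) / (1 - conj w * z)) = (1 - conj w * w) / (1 - conj w * z) := by
      rw [map_neg]
      field_simp
      ring
    simp only [hφ]
    rw [h1]
    rw [div_eq_iff (div_ne_zero hww hne), sub_neg_eq_add, mul_div_assoc', div_add' _ _ _ hne]
    congr 1
    ring
  have hne2 := one_sub_conj_mul_ne_zero (hmem hw).le (hmem hz)
  simp only [hg, hφz] at key
  rwa [norm_div, norm_div, div_le_div_iff₀ (norm_pos_iff.mpr hne2) (norm_pos_iff.mpr hne)] at key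

/-- The Cayley transform centred at `q w` reduces this to the disk. Strict positivity keeps its
denominator nonzero and its image in the open disk. -/
theorem schwarz_pick_half_plane_of_pos {q : ℂ → ℂ} (hq : DifferentiableOn ℂ q (ball 0 1))
    (hpos : ∀ z, ‖z‖ < 1 → 0 < (q z).re) {z w : ℂ} (hz : ‖z‖ < 1) (hw : ‖w‖ < 1) :
    ‖q z + conj (q w)‖ ^ 2 * ((1 - ‖w‖ ^ 2) * (1 - ‖z‖ ^ 2)) ≤
      4 * ((q z).re * (q w).re) * ‖1 - conj w * z‖ ^ 2 := by
  have hne : ∀ u, ‖u‖ < 1 → q u + conj (q w) ≠ 0 := by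
    intro u hu h
    have := congrArg Complex.re h
    simp at this
    linarith [hpos u hu, hpos w hw]
  set h : ℂ → ℂ := fun u => (q u - q w) / (q u + conj (q w)) with hh
  have hd : DifferentiableOn ℂ h (ball 0 1) := by
    apply DifferentiableOn.div (by fun_prop) (by fun_prop)
    intro u hu
    exact hne u (mem_ball_zero_iff.mp hu)
  have hm : MapsTo h (ball 0 1) (ball 0 1) := by
    intro u hu
    rw [mem_ball_zero_iff] at hu ⊢
    have h0 := norm_pos_iff.mpr (hne u hu)
    simp only [hh]
    rw [norm_div, div_lt_one h0]
    refine lt_of_pow_lt_pow_left₀ 2 h0.le ?_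
    rw [normSq_add_conj]
    have := mul_pos (hpos u hu) (hpos w hw)
    linarith
  have key := schwarz_pick_disk hd hm hz hw
  have hhw : h w = 0 := by simp [hh]
  have h0 := norm_pos_iff.mpr (hne z hz)
  rw [hhw] at key
  simp only [hh, map_zero, zero_mul, sub_zero, norm_one, mul_one, norm_div] at key
  rw [div_mul_eq_mul_div, div_le_iff₀ h0] at key
  have k2 := pow_le_pow_left₀ (by positivity) key 2
  rw [mul_pow, mul_pow] at k2
  have e1 := normSq_one_sub_conj_mul w z
  have e2 := normSq_add_conj (q z) (q w)
  have e3 : (1 - ‖w‖ ^ 2) * (1 - ‖z‖ ^ 2) = ‖1 - conj w * z‖ ^ 2 - ‖z - w‖ ^ 2 := by linarith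
  have e4 : 4 * ((q z).re * (q w).re) = ‖q z + conj (q w)‖ ^ 2 - ‖q z - q w‖ ^ 2 := by linarith
  rw [e3, e4]
  linarith

/-- The **Schwarz-Pick lemma** for holomorphic maps from the unit disk to the closed right
half-plane. -/
theorem schwarz_pick_half_plane {q : ℂ → ℂ} (hq : DifferentiableOn ℂ q (ball 0 1))
    (hpos : ∀ z, ‖z‖ < 1 → 0 ≤ (q z).re) {z w : ℂ} (hz : ‖z‖ < 1) (hw : ‖w‖ < 1) :
    ‖q z + conj (q w)‖ ^ 2 * ((1 - ‖w‖ ^ 2) * (1 - ‖z‖ ^ 2)) ≤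
      4 * ((q z).re * (q w).re) * ‖1 - conj w * z‖ ^ 2 := by
  have hε : ∀ ε : ℝ, 0 < ε →
      ‖(q z + ε) + conj (q w + ε)‖ ^ 2 * ((1 - ‖w‖ ^ 2) * (1 - ‖z‖ ^ 2)) ≤
      4 * ((q z + ε).re * (q w + ε).re) * ‖1 - conj w * z‖ ^ 2 := by
    intro ε hε
    refine schwarz_pick_half_plane_of_pos (q := fun u => q u + ε) (by fun_prop) ?_ hz hw
    intro u hu
    have := hpos u hu
    simp
    linarith
  have c1 : Continuous fun ε : ℝ =>
      ‖(q z + ε) + conj (q w + ε)‖ ^ 2 * ((1 - ‖w‖ ^ 2) * (1 - ‖z‖ ^ 2)) := by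
    fun_prop
  have c2 : Continuous fun ε : ℝ =>
      4 * ((q z + ε).re * (q w + ε).re) * ‖1 - conj w * z‖ ^ 2 := by
    fun_prop
  have := le_of_tendsto_of_tendsto ((c1.tendsto 0).mono_left nhdsWithin_le_nhds)
    ((c2.tendsto 0).mono_left nhdsWithin_le_nhds)
    (eventually_mem_nhdsWithin.mono fun ε (he : ε ∈ Ioi (0 : ℝ)) => hε ε he)
  simpa using this

/-! ### Horocycles at the Denjoy–Wolff point -/

/-- A positive sequence tending to zero is infinitely often non-increasing. -/
theorem frequently_succ_le_of_tendsto_zero {u : ℕ → ℝ} (hpos : ∀ n, 0 < u n)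
    (hu : Tendsto u atTop (𝓝 0)) : ∃ᶠ n in atTop, u (n + 1) ≤ u n := by
  intro h
  obtain ⟨n₀, hn₀⟩ := eventually_atTop.mp h
  have hmono : ∀ k, u n₀ ≤ u (n₀ + k) := by
    intro k
    induction k with
    | zero => simp
    | succ k ih => exact ih.trans (not_le.mp (hn₀ (n₀ + k) (by omega))).le
  have h1 : Tendsto (fun k => u (n₀ + k)) atTop (𝓝 0) := by
    simpa [add_comm] using (tendsto_add_atTop_iff_nat n₀).mpr hu
  exact absurd (ge_of_tendsto' h1 hmono) (not_le.mpr (hpos n₀))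

/-- If an orbit of a holomorphic self-map of the disk tends to `1`, the map does not increase
horocycles at `1`. -/
theorem horocycle_le_of_orbit_tendsto {G : ℂ → ℂ} (hG : DifferentiableOn ℂ G (ball 0 1))
    (hmaps : MapsTo G (ball 0 1) (ball 0 1)) {w : ℕ → ℂ} (hw : ∀ n, ‖w n‖ < 1)
    (hstep : ∀ n, w (n + 1) = G (w n)) (hlim : Tendsto w atTop (𝓝 1)) {z : ℂ} (hz : ‖z‖ < 1) :
    ‖1 - G z‖ ^ 2 * (1 - ‖z‖ ^ 2) ≤ ‖1 - z‖ ^ 2 * (1 - ‖G z‖ ^ 2) := by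
  have hGz : ‖G z‖ < 1 := by simpa using hmaps (mem_ball_zero_iff.mpr hz)
  have hone : ∀ {v : ℂ}, ‖v‖ < 1 → 0 < 1 - ‖v‖ ^ 2 := fun {v} hv => by
    nlinarith [norm_nonneg v]
  have hineq : ∀ n, ‖1 - conj (w (n + 1)) * G z‖ ^ 2 * ((1 - ‖w n‖ ^ 2) * (1 - ‖z‖ ^ 2)) ≤
      ‖1 - conj (w n) * z‖ ^ 2 * ((1 - ‖w (n + 1)‖ ^ 2) * (1 - ‖G z‖ ^ 2)) := by
    intro n
    have h := pow_le_pow_left₀ (by positivity) (schwarz_pick_disk hG hmaps hz (hw n)) 2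
    rw [← hstep, mul_pow, mul_pow] at h
    have e1 := normSq_one_sub_conj_mul (w n) z
    have e2 := normSq_one_sub_conj_mul (w (n + 1)) (G z)
    have e3 : (1 - ‖w n‖ ^ 2) * (1 - ‖z‖ ^ 2) = ‖1 - conj (w n) * z‖ ^ 2 - ‖z - w n‖ ^ 2 := by
      linarith
    have e4 : (1 - ‖w (n + 1)‖ ^ 2) * (1 - ‖G z‖ ^ 2) =
        ‖1 - conj (w (n + 1)) * G z‖ ^ 2 - ‖G z - w (n + 1)‖ ^ 2 := by linarith
    rw [e3, e4]
    linarith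
  have hu : Tendsto (fun n => 1 - ‖w n‖ ^ 2) atTop (𝓝 0) := by
    have := ((hlim.norm.pow 2).const_sub 1)
    simpa using this
  have hfreq := frequently_succ_le_of_tendsto_zero (fun n => hone (hw n)) hu
  -- Wherever `1 - ‖w n‖ ^ 2` does not grow, this factor cancels from Schwarz–Pick; infinitely many
  -- such `n` suffice to pass to the limit.
  have hfreq' : ∃ᶠ n in atTop, 0 ≤ ‖1 - conj (w n) * z‖ ^ 2 * (1 - ‖G z‖ ^ 2) -
      ‖1 - conj (w (n + 1)) * G z‖ ^ 2 * (1 - ‖z‖ ^ 2) := by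
    refine hfreq.mono fun n hn => ?_
    have h1 := hineq n
    have h2 : ‖1 - conj (w n) * z‖ ^ 2 * ((1 - ‖w (n + 1)‖ ^ 2) * (1 - ‖G z‖ ^ 2)) ≤
        ‖1 - conj (w n) * z‖ ^ 2 * ((1 - ‖w n‖ ^ 2) * (1 - ‖G z‖ ^ 2)) := by
      have := (hone hGz).le
      gcongr
    have h3 : 0 ≤ (1 - ‖w n‖ ^ 2) * (‖1 - conj (w n) * z‖ ^ 2 * (1 - ‖G z‖ ^ 2) -
      ‖1 - conj (w (n + 1)) * G z‖ ^ 2 * (1 - ‖z‖ ^ 2)) := by linarith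
    exact nonneg_of_mul_nonneg_right h3 (hone (hw n))
  have hlim' : Tendsto (fun n => w (n + 1)) atTop (𝓝 1) := (tendsto_add_atTop_iff_nat 1).mpr hlim
  have hc : ∀ x : ℂ, Continuous fun v : ℂ => ‖1 - conj v * x‖ ^ 2 := fun x => by
    have := Complex.continuous_conj
    fun_prop
  have ht : Tendsto (fun n => ‖1 - conj (w n) * z‖ ^ 2 * (1 - ‖G z‖ ^ 2) -
      ‖1 - conj (w (n + 1)) * G z‖ ^ 2 * (1 - ‖z‖ ^ 2)) atTop
      (𝓝 (‖1 - conj 1 * z‖ ^ 2 * (1 - ‖G z‖ ^ 2) - ‖1 - conj 1 * G z‖ ^ 2 * (1 - ‖z‖ ^ 2))) :=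
    ((((hc z).tendsto 1).comp hlim).mul_const _).sub ((((hc (G z)).tendsto 1).comp hlim').mul_const _)
  have hfin := ge_of_tendsto_of_frequently ht hfreq'
  simp only [map_one, one_mul] at hfin
  linarith

/-! ### The Berkson–Porta inequality and absence of zeros -/

section Semigroup

variable {F : ℝ → ℂ → ℂ} {f : ℂ → ℂ}

theorem IsDiskSemigroup.norm_lt_one (hF : IsDiskSemigroup F) {t : ℝ} (ht : 0 ≤ t) {z : ℂ}
    (hz : ‖z‖ < 1) : ‖F t z‖ < 1 := by
  simpa using hF.mapsTo t ht (mem_ball_zero_iff.mpr hz)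

theorem IsDiskSemigroup.horocycle_le (hF : IsDiskSemigroup F) (hDW : IsDenjoyWolffPoint F 1)
    {t : ℝ} (ht : 0 < t) {z : ℂ} (hz : ‖z‖ < 1) :
    ‖1 - F t z‖ ^ 2 * (1 - ‖z‖ ^ 2) ≤ ‖1 - z‖ ^ 2 * (1 - ‖F t z‖ ^ 2) := by
  refine horocycle_le_of_orbit_tendsto (w := fun n : ℕ => F (n * t) 0) (hF.holomorphic t ht.le)
    (hF.mapsTo t ht.le) (fun n => hF.norm_lt_one (by positivity) (by simp)) ?_ ?_ hz
  · intro n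
    rw [← hF.add t (n * t) ht.le (by positivity) 0 (by simp)]
    congr 1
    push_cast
    ring
  · exact (hDW.2 0 (by simp)).comp (tendsto_natCast_atTop_atTop.atTop_mul_const ht)

/-- The Berkson-Porta inequality for a semigroup with Denjoy-Wolff point `1`. -/
theorem berkson_porta_re_nonneg (hF : IsDiskSemigroup F) (hf : IsInfinitesimalGenerator f F)
    (hDW : IsDenjoyWolffPoint F 1) {z : ℂ} (hz : ‖z‖ < 1) : 0 ≤ (-f z / (1 - z) ^ 2).re := by
  have hne : ∀ {v : ℂ}, ‖v‖ < 1 → 1 - v ≠ 0 := fun {v} hv h => by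
    rw [← sub_eq_zero.mp h] at hv
    simp at hv
  have hre : ∀ {v : ℂ}, ‖v‖ < 1 → ((1 + v) / (1 - v)).re = (1 - ‖v‖ ^ 2) / ‖1 - v‖ ^ 2 := by
    intro v hv
    rw [Complex.div_re, Complex.normSq_eq_norm_sq, ← add_div]
    congr 1
    rw [← Complex.normSq_eq_norm_sq, Complex.normSq_apply]
    simp
    ring
  have hmem : z ∈ ball (0 : ℂ) 1 := mem_ball_zero_iff.mpr hz
  have hlim := hf.2 z hmem
  have hFz : Tendsto (fun t : ℝ => F t z) (𝓝[>] 0) (𝓝 z) := by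
    have h0 : Tendsto (fun t : ℝ => (t : ℂ)) (𝓝[>] 0) (𝓝 0) := by
      have := (Complex.continuous_ofReal.tendsto 0).mono_left
        (nhdsWithin_le_nhds (s := Ioi (0 : ℝ)))
      simpa using this
    have h1 := (h0.mul hlim).const_sub z
    rw [zero_mul, sub_zero] at h1
    refine h1.congr' ?_
    filter_upwards [self_mem_nhdsWithin] with t (ht : 0 < t)
    have : (t : ℂ) ≠ 0 := by exact_mod_cast ht.ne'
    field_simp
    ring
  -- This is the difference quotient at `t = 0` of `(1 + v) / (1 - v)` along the orbit `v = F t z`;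
  -- the horocycle inequality says that its real part is nonnegative.
  have hq : Tendsto (fun t : ℝ => -2 * ((z - F t z) / (t : ℂ)) / ((1 - F t z) * (1 - z)))
      (𝓝[>] 0) (𝓝 (-2 * f z / ((1 - z) * (1 - z)))) :=
    (hlim.const_mul (-2)).div ((hFz.const_sub 1).mul_const _) (mul_ne_zero (hne hz) (hne hz))
  have hq' := (Complex.continuous_re.tendsto _).comp hq
  have hnn : 0 ≤ (-2 * f z / ((1 - z) * (1 - z))).re := by
    refine ge_of_tendsto hq' ?_
    filter_upwards [self_mem_nhdsWithin] with t (ht : 0 < t)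
    have hFt := hF.norm_lt_one ht.le hz
    have h1 := hne hz
    have h2 := hne hFt
    have ht' : (t : ℂ) ≠ 0 := by exact_mod_cast ht.ne'
    have e : -2 * ((z - F t z) / (t : ℂ)) / ((1 - F t z) * (1 - z)) =
        (((1 + F t z) / (1 - F t z) - (1 + z) / (1 - z))) / (t : ℂ) := by
      field_simp
      ring
    simp only [Function.comp]
    rw [e, Complex.div_ofReal_re, Complex.sub_re, hre hz, hre hFt]
    refine div_nonneg (sub_nonneg.mpr ?_) ht.le
    rw [div_le_div_iff₀ (pow_pos (norm_pos_iff.mpr h1) 2) (pow_pos (norm_pos_iff.mpr h2) 2)]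
    have := hF.horocycle_le hDW ht hz
    linarith
  have e : -2 * f z / ((1 - z) * (1 - z)) = (2 : ℝ) * (-f z / (1 - z) ^ 2) := by
    push_cast
    ring
  rw [e, Complex.re_ofReal_mul] at hnn
  linarith

/-- A zero of the generator is a fixed point of the semigroup. -/
theorem IsDiskSemigroup.fixed_of_generator_eq_zero (hF : IsDiskSemigroup F)
    (hf : IsInfinitesimalGenerator f F) {z : ℂ} (hz : ‖z‖ < 1) (h0 : f z = 0) {t : ℝ}
    (ht : 0 < t) : F t z = z := by
  have hmem : z ∈ ball (0 : ℂ) 1 := mem_ball_zero_iff.mpr hz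
  -- By Schwarz–Pick for `F s`, a time step `h` moves the orbit by at most a constant, independent
  -- of `s`, times its initial displacement.
  have hstep : ∀ s h : ℝ, 0 ≤ s → 0 ≤ h →
      ‖F (s + h) z - F s z‖ ≤ 2 / (1 - ‖z‖) * ‖z - F h z‖ := by
    intro s h hs hh
    have hFh := hF.norm_lt_one hh hz
    have hsp := schwarz_pick_disk (hF.holomorphic s hs) (hF.mapsTo s hs) hFh hz
    rw [← hF.add s h hs hh z hmem] at hsp
    have hlow : 1 - ‖z‖ ≤ ‖1 - conj z * F h z‖ := by
      have h1 := norm_sub_norm_le (1 : ℂ) (conj z * F h z)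
      rw [norm_one, norm_mul, Complex.norm_conj] at h1
      nlinarith [norm_nonneg z, norm_nonneg (F h z)]
    have hup : ‖1 - conj (F s z) * F (s + h) z‖ ≤ 2 := by
      have h1 := norm_sub_le (1 : ℂ) (conj (F s z) * F (s + h) z)
      rw [norm_one, norm_mul, Complex.norm_conj] at h1
      have h2 := hF.norm_lt_one hs hz
      have h3 := hF.norm_lt_one (add_nonneg hs hh) hz
      nlinarith [norm_nonneg (F s z), norm_nonneg (F (s + h) z)]
    have hpos : 0 < 1 - ‖z‖ := by linarith
    rw [div_mul_eq_mul_div, le_div_iff₀ hpos, norm_sub_rev z]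
    calc _ ≤ ‖F (s + h) z - F s z‖ * ‖1 - conj z * F h z‖ := by gcongr
      _ ≤ _ := hsp
      _ ≤ ‖F h z - z‖ * 2 := by gcongr
      _ = _ := by ring
  have hsum : ∀ (h : ℝ), 0 ≤ h → ∀ n : ℕ,
      ‖F (n * h) z - z‖ ≤ n * (2 / (1 - ‖z‖) * ‖z - F h z‖) := by
    intro h hh n
    induction n with
    | zero => simp [hF.zero z hmem]
    | succ n ih =>
      have h1 := hstep (n * h) h (by positivity) hh
      have h2 := norm_add_le (F (n * h + h) z - F (n * h) z) (F (n * h) z - z)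
      rw [sub_add_sub_cancel] at h2
      have e : ((n + 1 : ℕ) : ℝ) * h = n * h + h := by push_cast; ring
      rw [e]
      push_cast
      linarith
  have hlim := hf.2 z hmem
  rw [h0] at hlim
  -- Cutting `t` into `n + 1` equal steps bounds the total displacement by a constant times the
  -- difference quotient, which tends to `f z = 0`.
  have hseq : Tendsto (fun n : ℕ => t / ((n : ℝ) + 1)) atTop (𝓝[>] 0) := by
    refine tendsto_nhdsWithin_iff.mpr ⟨?_, Eventually.of_forall fun n => by
      simp only [mem_Ioi]; positivity⟩
    exact tendsto_const_nhds.div_atTop (tendsto_natCast_atTop_atTop.atTop_add tendsto_const_nhds)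
  have h1 := ((hlim.comp hseq).norm).const_mul (2 / (1 - ‖z‖) * t)
  rw [norm_zero, mul_zero] at h1
  have h2 : ‖F t z - z‖ ≤ 0 := by
    refine ge_of_tendsto' h1 fun n => ?_
    have h3 := hsum (t / ((n : ℝ) + 1)) (by positivity) (n + 1)
    have hn : (n : ℝ) + 1 ≠ 0 := by positivity
    have e1 : ((n + 1 : ℕ) : ℝ) * (t / ((n : ℝ) + 1)) = t := by
      push_cast
      field_simp
    rw [e1] at h3
    refine h3.trans (le_of_eq ?_)
    simp only [Function.comp]
    rw [norm_div, Complex.norm_real, Real.norm_eq_abs, abs_of_pos (by positivity)]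
    push_cast
    field_simp
  exact sub_eq_zero.mp (norm_le_zero_iff.mp h2)

theorem generator_ne_zero (hF : IsDiskSemigroup F) (hf : IsInfinitesimalGenerator f F)
    (hDW : IsDenjoyWolffPoint F 1) {z : ℂ} (hz : ‖z‖ < 1) : f z ≠ 0 := by
  intro h0
  have h1 := hDW.2 z (mem_ball_zero_iff.mpr hz)
  have h2 : Tendsto (fun t : ℝ => F t z) atTop (𝓝 z) := by
    refine tendsto_const_nhds.congr' ?_
    filter_upwards [eventually_gt_atTop 0] with t ht
    exact (hF.fixed_of_generator_eq_zero hf hz h0 ht).symm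
  rw [tendsto_nhds_unique h2 h1] at hz
  simp at hz

end Semigroup

/-! ### Angular limits along segments -/

/-- A segment entering the disk at `ζ` in direction `-ζ v` is eventually nontangential, with
aperture governed by `‖v‖ / re v`. Allowing all such `v`, not just the radius, is what later forces
residues to be real. -/
theorem tendsto_stolzRegion_of_re_pos {ζ v : ℂ} (hζ : ‖ζ‖ = 1) (hv : 0 < v.re) :
    ∃ M : ℝ, 1 < M ∧
      Tendsto (fun s : ℝ => ζ * (1 - s * v)) (𝓝[>] 0) (𝓝[stolzRegion ζ M] ζ) := by
  have hv0 : 0 < ‖v‖ := lt_of_lt_of_le hv (Complex.re_le_norm v)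
  refine ⟨2 * ‖v‖ / v.re + 2, by linarith [show 0 ≤ 2 * ‖v‖ / v.re by positivity],
    tendsto_nhdsWithin_iff.mpr ⟨?_, ?_⟩⟩
  · have hc : Continuous fun s : ℝ => ζ * (1 - s * v) := by fun_prop
    simpa using (hc.tendsto 0).mono_left (nhdsWithin_le_nhds (s := Ioi (0 : ℝ)))
  · have hpos : 0 < v.re / ‖v‖ ^ 2 := by positivity
    filter_upwards [Ioo_mem_nhdsGT hpos] with s hs
    obtain ⟨hs0, hs1⟩ := hs
    rw [lt_div_iff₀ (by positivity)] at hs1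
    have hsq : ‖(1 - s * v : ℂ)‖ ^ 2 = 1 - 2 * s * v.re + s * (s * ‖v‖ ^ 2) := by
      simp only [← Complex.normSq_eq_norm_sq, Complex.normSq_apply]
      simp
      ring
    have hle : ‖(1 - s * v : ℂ)‖ ^ 2 ≤ 1 - s * v.re := by nlinarith
    have hsv : 0 < s * v.re := mul_pos hs0 hv
    have hn0 := norm_nonneg (1 - s * v : ℂ)
    have hlt : ‖(1 - s * v : ℂ)‖ < 1 := by nlinarith
    have hlow : s * v.re ≤ 2 * (1 - ‖(1 - s * v : ℂ)‖) := by nlinarith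
    have e1 : ‖ζ * (1 - s * v)‖ = ‖(1 - s * v : ℂ)‖ := by rw [norm_mul, hζ, one_mul]
    have e2 : ‖ζ * (1 - s * v) - ζ‖ = s * ‖v‖ := by
      rw [show ζ * (1 - s * v) - ζ = -(ζ * (s * v)) by ring, norm_neg, norm_mul, hζ, one_mul,
        norm_mul, Complex.norm_real, Real.norm_eq_abs, abs_of_pos hs0]
    refine ⟨by rw [e1]; exact hlt, ?_⟩
    rw [e1, e2]
    have h3 : 2 * ‖v‖ / v.re * (s * v.re) ≤ 2 * ‖v‖ / v.re * (2 * (1 - ‖(1 - s * v : ℂ)‖)) := by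
      gcongr
    have h4 : 2 * ‖v‖ / v.re * (s * v.re) = 2 * (s * ‖v‖) := by field_simp
    nlinarith [mul_pos hs0 hv0]

theorem HasAngularLimit.tendsto_path {h : ℂ → ℂ} {ζ L v : ℂ} (hL : HasAngularLimit h ζ L)
    (hζ : ‖ζ‖ = 1) (hv : 0 < v.re) :
    Tendsto (fun s : ℝ => h (ζ * (1 - s * v))) (𝓝[>] 0) (𝓝 L) := by
  obtain ⟨M, hM, ht⟩ := tendsto_stolzRegion_of_re_pos hζ hv
  exact (hL M hM).comp ht

theorem eventually_norm_path_lt_one {ζ v : ℂ} (hζ : ‖ζ‖ = 1) (hv : 0 < v.re) :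
    ∀ᶠ s : ℝ in 𝓝[>] 0, ‖ζ * (1 - s * v)‖ < 1 := by
  obtain ⟨M, hM, ht⟩ := tendsto_stolzRegion_of_re_pos hζ hv
  exact ((tendsto_nhdsWithin_iff.mp ht).2).mono fun s hs => hs.1

theorem HasAngularLimit.unique {h : ℂ → ℂ} {ζ L L' : ℂ} (hL : HasAngularLimit h ζ L)
    (hL' : HasAngularLimit h ζ L') (hζ : ‖ζ‖ = 1) : L = L' :=
  tendsto_nhds_unique (hL.tendsto_path hζ (v := 1) (by simp))
    (hL'.tendsto_path hζ (v := 1) (by simp))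

theorem one_sub_conj_mul_path {ζ v : ℂ} (hζ : ‖ζ‖ = 1) (s : ℝ) :
    1 - conj ζ * (ζ * (1 - s * v)) = s * v := by
  have : conj ζ * ζ = 1 := by
    rw [← Complex.normSq_eq_conj_mul_self, Complex.normSq_eq_norm_sq, hζ]
    simp
  linear_combination (-(1 - s * v)) * this

theorem norm_one_sub_conj_mul_eq {ζ : ℂ} (hζ : ‖ζ‖ = 1) (z : ℂ) :
    ‖1 - conj ζ * z‖ = ‖ζ - z‖ := by
  rw [← sq_eq_sq₀ (norm_nonneg _) (norm_nonneg _), normSq_one_sub_conj_mul, hζ, norm_sub_rev]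
  ring

/-! ### Boundary point masses, their removal, and rigidity -/

/-- If `q` has nonnegative real part, the angular limit of `(1 - conj ζ * z) * q z` at `ζ` is a
nonnegative real number. -/
theorem angular_residue_nonneg {q : ℂ → ℂ} (hpos : ∀ z, ‖z‖ < 1 → 0 ≤ (q z).re) {ζ α : ℂ}
    (hζ : ‖ζ‖ = 1) (hα : HasAngularLimit (fun z => (1 - conj ζ * z) * q z) ζ α) :
    α.im = 0 ∧ 0 ≤ α.re := by
  have key : ∀ v : ℂ, 0 < v.re → 0 ≤ (α / v).re := by
    intro v hv
    have hv0 : v ≠ 0 := fun h => by simp [h] at hv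
    have h1 := (hα.tendsto_path hζ hv).div_const v
    have h2 := (Complex.continuous_re.tendsto _).comp h1
    refine ge_of_tendsto h2 ?_
    filter_upwards [eventually_norm_path_lt_one hζ hv, self_mem_nhdsWithin] with s hs1 hs0
    simp only [Function.comp]
    rw [one_sub_conj_mul_path hζ, show s * v * q (ζ * (1 - s * v)) / v =
      (s : ℂ) * q (ζ * (1 - s * v)) by field_simp, Complex.re_ofReal_mul]
    exact mul_nonneg (le_of_lt hs0) (hpos _ hs1)
  -- Taking `v = 1 / (1 + t i)` gives an affine function of `t` that is nonnegative on the whole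
  -- line, so its slope vanishes.
  have key' : ∀ t : ℝ, 0 ≤ α.re - α.im * t := by
    intro t
    have hu : (1 + t * Complex.I : ℂ).re = 1 := by simp
    have hu0 : (1 + t * Complex.I : ℂ) ≠ 0 := fun h => by rw [h] at hu; simp at hu
    have h := key (1 + t * Complex.I)⁻¹ (by
      rw [Complex.inv_re, hu]
      exact div_pos one_pos (Complex.normSq_pos.mpr hu0))
    rw [div_inv_eq_mul] at h
    simpa using h
  refine ⟨?_, by simpa using key' 0⟩
  by_contra hb
  have h := key' ((α.re + 1) / α.im)
  rw [mul_div_cancel₀ _ hb] at h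
  linarith

/-- A **Julia lemma** for holomorphic functions with nonnegative real part. -/
theorem julia_half_plane {q : ℂ → ℂ} (hq : DifferentiableOn ℂ q (ball 0 1))
    (hpos : ∀ z, ‖z‖ < 1 → 0 ≤ (q z).re) {ζ : ℂ} {α : ℝ} (hζ : ‖ζ‖ = 1) (hα0 : 0 < α)
    (hα : HasAngularLimit (fun z => (1 - conj ζ * z) * q z) ζ α) {z : ℂ} (hz : ‖z‖ < 1) :
    α * (1 - ‖z‖ ^ 2) ≤ 2 * (q z).re * ‖ζ - z‖ ^ 2 := by
  have hv : 0 < (1 : ℂ).re := by simp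
  have hlim : Tendsto (fun s : ℝ => (s : ℂ) * q (ζ * (1 - s * 1))) (𝓝[>] 0) (𝓝 α) := by
    refine (hα.tendsto_path hζ hv).congr fun s => ?_
    rw [one_sub_conj_mul_path hζ, mul_one]
  have hs : Tendsto (fun s : ℝ => s) (𝓝[>] (0 : ℝ)) (𝓝 0) := nhdsWithin_le_nhds
  have hsc : Tendsto (fun s : ℝ => (s : ℂ)) (𝓝[>] (0 : ℝ)) (𝓝 0) := by
    simpa [Function.comp_def] using (Complex.continuous_ofReal.tendsto 0).comp hs
  have hconj := (Complex.continuous_conj.tendsto _).comp hlim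
  have hpath : Tendsto (fun s : ℝ => ζ * (1 - s * 1)) (𝓝[>] 0) (𝓝 ζ) := by
    simpa using ((hsc.mul_const 1).const_sub 1).const_mul ζ
  -- Schwarz–Pick between `z` and the radial point `ζ (1 - s)` is multiplied by `s`. Since `s (1 -
  -- (1 - s)^2) = s^2 (2 - s)`, both sides have finite limits, and a factor `α` cancels at the end.
  have hl := ((((hsc.mul_const (q z)).add hconj).norm.pow 2)).mul
    ((hs.const_sub 2).mul_const (1 - ‖z‖ ^ 2))
  have hr := ((((Complex.continuous_re.tendsto _).comp hlim).const_mul (q z).re).const_mul 4).mul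
    (((((Complex.continuous_conj.tendsto _).comp hpath).mul_const z).const_sub 1).norm.pow 2)
  have hfin := le_of_tendsto_of_tendsto hl hr (by
    filter_upwards [eventually_norm_path_lt_one hζ hv, self_mem_nhdsWithin,
      Ioo_mem_nhdsGT (zero_lt_one' ℝ)] with s hs1 hs0 hs2
    have hs0' : 0 < s := hs0
    have h := schwarz_pick_half_plane hq hpos hz hs1
    have e1 : ‖ζ * (1 - (s : ℂ) * 1)‖ = 1 - s := by
      rw [norm_mul, hζ, one_mul, mul_one, show (1 - s : ℂ) = ((1 - s : ℝ) : ℂ) by push_cast; ring,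
        Complex.norm_real, Real.norm_eq_abs, abs_of_pos (by linarith [hs2.2])]
    rw [e1] at h
    have e2 : ‖(s : ℂ) * q z + conj ((s : ℂ) * q (ζ * (1 - s * 1)))‖ =
        s * ‖q z + conj (q (ζ * (1 - s * 1)))‖ := by
      rw [map_mul, Complex.conj_ofReal, ← mul_add, norm_mul, Complex.norm_real, Real.norm_eq_abs,
        abs_of_pos hs0']
    simp only [Function.comp]
    rw [e2, Complex.re_ofReal_mul]
    have h' := mul_le_mul_of_nonneg_left h hs0'.le
    calc _ = s * (‖q z + conj (q (ζ * (1 - s * 1)))‖ ^ 2 * ((1 - (1 - s) ^ 2) * (1 - ‖z‖ ^ 2))) := by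
          ring
      _ ≤ _ := h'
      _ = _ := by ring)
  rw [norm_one_sub_conj_mul_eq hζ] at hfin
  simp only [zero_mul, zero_add, sub_zero, Complex.conj_ofReal, Complex.norm_real,
    Real.norm_eq_abs, sq_abs, Complex.ofReal_re] at hfin
  have : α * (α * (1 - ‖z‖ ^ 2)) ≤ α * (2 * (q z).re * ‖ζ - z‖ ^ 2) := by linarith
  exact le_of_mul_le_mul_left this hα0

/-- The Poisson kernel: it makes Julia's bound say that `α / 2` times the Herglotz kernel can be
subtracted. -/
theorem re_add_div_sub {ζ z : ℂ} (hζ : ‖ζ‖ = 1) :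
    ((ζ + z) / (ζ - z)).re = (1 - ‖z‖ ^ 2) / ‖ζ - z‖ ^ 2 := by
  rw [Complex.div_re, Complex.normSq_eq_norm_sq, ← add_div]
  congr 1
  have h1 : ζ.re * ζ.re + ζ.im * ζ.im = 1 := by
    rw [← Complex.normSq_apply, Complex.normSq_eq_norm_sq, hζ, one_pow]
  rw [← Complex.normSq_eq_norm_sq, Complex.normSq_apply]
  simp
  linarith

theorem sub_ne_zero_of_norm_eq_one {ζ z : ℂ} (hζ : ‖ζ‖ = 1) (hz : ‖z‖ < 1) : ζ - z ≠ 0 := by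
  intro h
  rw [sub_eq_zero.mp h] at hζ
  linarith

/-- Removing finitely many boundary point masses from a holomorphic function with nonnegative real
part leaves a function with nonnegative real part. -/
theorem re_sub_sum_nonneg {q : ℂ → ℂ} (hq : DifferentiableOn ℂ q (ball 0 1))
    (hpos : ∀ z, ‖z‖ < 1 → 0 ≤ (q z).re) {ι : Type*} (ζ : ι → ℂ) (hinj : Function.Injective ζ)
    (hζ : ∀ n, ‖ζ n‖ = 1) (α : ι → ℝ) (hα0 : ∀ n, 0 < α n)
    (hα : ∀ n, HasAngularLimit (fun z => (1 - conj (ζ n) * z) * q z) (ζ n) (α n))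
    (S : Finset ι) : ∀ z, ‖z‖ < 1 →
      0 ≤ (q z - ∑ n ∈ S, ((α n / 2 : ℝ) : ℂ) * ((ζ n + z) / (ζ n - z))).re := by
  classical
  induction S using Finset.induction_on with
  | empty => simpa using hpos
  | insert k S hk ih =>
    intro z hz
    have hd : DifferentiableOn ℂ
        (fun z => q z - ∑ n ∈ S, ((α n / 2 : ℝ) : ℂ) * ((ζ n + z) / (ζ n - z))) (ball 0 1) := by
      refine hq.sub (DifferentiableOn.fun_sum fun n _ => DifferentiableOn.const_mul ?_ _)
      refine DifferentiableOn.div (by fun_prop) (by fun_prop) fun u hu => ?_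
      exact sub_ne_zero_of_norm_eq_one (hζ n) (mem_ball_zero_iff.mp hu)
    have hang : HasAngularLimit (fun z => (1 - conj (ζ k) * z) *
        (q z - ∑ n ∈ S, ((α n / 2 : ℝ) : ℂ) * ((ζ n + z) / (ζ n - z)))) (ζ k) (α k) := by
      intro M hM
      -- The kernels already removed are continuous at `ζ k`, where the prefactor vanishes, so they
      -- leave the mass there unchanged.
      have hc : ContinuousAt (fun z => (1 - conj (ζ k) * z) *
          ∑ n ∈ S, ((α n / 2 : ℝ) : ℂ) * ((ζ n + z) / (ζ n - z))) (ζ k) := by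
        refine ContinuousAt.mul (by fun_prop) (tendsto_finsetSum _ fun n hn => ?_)
        refine ContinuousAt.mul continuousAt_const (ContinuousAt.div (by fun_prop) (by fun_prop) ?_)
        refine sub_ne_zero.mpr fun h => hk ?_
        rwa [← hinj h]
      have hone : 1 - conj (ζ k) * ζ k = 0 := by
        rw [← norm_eq_zero, norm_one_sub_conj_mul_eq (hζ k), sub_self, norm_zero]
      have h1 := (hα k M hM).sub (hc.tendsto.mono_left nhdsWithin_le_nhds)
      rw [hone, zero_mul, sub_zero] at h1
      exact h1.congr fun z => by ring
    have hj := julia_half_plane hd ih (hζ k) (hα0 k) hang hz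
    rw [Finset.sum_insert hk]
    have hne := norm_pos_iff.mpr (sub_ne_zero_of_norm_eq_one (hζ k) hz)
    have e : (α k / 2) * ((ζ k + z) / (ζ k - z)).re ≤
        (q z - ∑ n ∈ S, ((α n / 2 : ℝ) : ℂ) * ((ζ n + z) / (ζ n - z))).re := by
      rw [re_add_div_sub (hζ k), ← mul_div_assoc, div_le_iff₀ (by positivity)]
      linarith
    rw [show ∀ a b c : ℂ, a - (b + c) = (a - c) - b by intros; ring, Complex.sub_re,
      Complex.re_ofReal_mul]
    linarith

/-- A holomorphic function with nonnegative real part and `re (g 0) = 0` is an imaginary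
constant. -/
theorem eq_imaginary_const_of_re_zero {g : ℂ → ℂ} (hg : DifferentiableOn ℂ g (ball 0 1))
    (hpos : ∀ z, ‖z‖ < 1 → 0 ≤ (g z).re) (h0 : (g 0).re = 0) {z : ℂ} (hz : ‖z‖ < 1) :
    g z = Complex.I * ((g 0).im : ℂ) := by
  have h := schwarz_pick_half_plane hg hpos hz (w := 0) (by simp)
  rw [h0] at h
  simp only [norm_zero, mul_zero, zero_mul] at h
  have h1 : 0 < 1 - ‖z‖ ^ 2 := by nlinarith [norm_nonneg z]
  have h2 : ‖g z + conj (g 0)‖ ^ 2 ≤ 0 := by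
    by_contra hc
    nlinarith [mul_pos (not_le.mp hc) h1]
  have h3 : g z + conj (g 0) = 0 := by
    rw [← norm_eq_zero]
    exact pow_eq_zero_iff (two_ne_zero) |>.mp (le_antisymm h2 (by positivity))
  rw [eq_neg_of_add_eq_zero_left h3]
  apply Complex.ext <;> simp [h0]

/-- Growth of a holomorphic function with nonnegative real part. -/
theorem norm_mul_le_of_re_nonneg {q : ℂ → ℂ} (hq : DifferentiableOn ℂ q (ball 0 1))
    (hpos : ∀ z, ‖z‖ < 1 → 0 ≤ (q z).re) {w : ℂ} (hw : ‖w‖ < 1) :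
    ‖q w‖ * (1 - ‖w‖ ^ 2) ≤ 5 * ‖q 0‖ := by
  have h := schwarz_pick_half_plane hq hpos hw (w := 0) (by simp)
  simp only [map_zero, zero_mul, sub_zero, norm_zero, norm_one] at h
  set X := ‖q w + conj (q 0)‖
  have hX : 0 ≤ X := norm_nonneg _
  have h1 : 0 < 1 - ‖w‖ ^ 2 := by nlinarith [norm_nonneg w]
  have hre0 := hpos 0 (by simp)
  have hrew : (q w).re ≤ X := by
    have := Complex.re_le_norm (q w + conj (q 0))
    simp only [Complex.add_re, Complex.conj_re] at this
    linarith
  have hA : (q 0).re ≤ ‖q 0‖ := Complex.re_le_norm _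
  have hX2 : X * (1 - ‖w‖ ^ 2) ≤ 4 * ‖q 0‖ := by
    rcases hX.eq_or_lt with h0 | h0
    · rw [← h0]; simp
    · refine le_of_mul_le_mul_left ?_ h0
      have : (q w).re * (q 0).re ≤ X * ‖q 0‖ := mul_le_mul hrew hA hre0 hX
      nlinarith
  have htri : ‖q w‖ ≤ X + ‖q 0‖ := by
    have := norm_sub_le (q w + conj (q 0)) (conj (q 0))
    rwa [add_sub_cancel_right, Complex.norm_conj] at this
  have h2 : ‖q 0‖ * (1 - ‖w‖ ^ 2) ≤ ‖q 0‖ := by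
    nlinarith [norm_nonneg (q 0), sq_nonneg ‖w‖, mul_nonneg (norm_nonneg (q 0)) (sq_nonneg ‖w‖)]
  nlinarith

/-! ### Angular derivatives of `f` as point masses of `q` -/

theorem conj_mul_one_sub_sq {ζ : ℂ} (hζ : ‖ζ‖ = 1) :
    conj ζ * (1 - ζ) ^ 2 = -((2 * (1 - ζ.re) : ℝ) : ℂ) := by
  have h1 : conj ζ * ζ = 1 := by
    rw [← Complex.normSq_eq_conj_mul_self, Complex.normSq_eq_norm_sq, hζ]
    simp
  have h2 := Complex.add_conj ζ
  push_cast at h2 ⊢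
  linear_combination (ζ - 2) * h1 + h2

theorem re_lt_one_of_norm_eq_one {ζ : ℂ} (hζ : ‖ζ‖ = 1) (hne : ζ ≠ 1) : ζ.re < 1 := by
  refine lt_of_le_of_ne (hζ ▸ Complex.re_le_norm ζ) fun h => hne ?_
  have h1 : ζ.re * ζ.re + ζ.im * ζ.im = 1 := by
    rw [← Complex.normSq_apply, Complex.normSq_eq_norm_sq, hζ, one_pow]
  rw [h] at h1
  refine Complex.ext h ?_
  have : ζ.im * ζ.im = 0 := by linarith
  simpa using this

/-- At a boundary regular null point of `f`, the function `q = -(1 - z) ^ 2 / f` carries a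
positive point mass, inversely proportional to the angular derivative of `f`. -/
theorem angular_deriv_neg {f q : ℂ → ℂ} (hf : ∀ z, ‖z‖ < 1 → f z ≠ 0)
    (hq : DifferentiableOn ℂ q (ball 0 1)) (hpos : ∀ z, ‖z‖ < 1 → 0 ≤ (q z).re)
    (hfq : ∀ z, ‖z‖ < 1 → q z = -(1 - z) ^ 2 / f z) {ζ m : ℂ} (hζ : ‖ζ‖ = 1) (hne : ζ ≠ 1)
    (hm : HasAngularLimit (fun z => f z / (z - ζ)) ζ m) :
    m.im = 0 ∧ m.re < 0 ∧ HasAngularLimit (fun z => (1 - conj ζ * z) * q z) ζ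
      ((2 * (1 - ζ.re) / ‖m‖ : ℝ) : ℂ) := by
  have hv : 0 < (1 : ℂ).re := by simp
  have hζζ : conj ζ * ζ = 1 := by
    rw [← Complex.normSq_eq_conj_mul_self, Complex.normSq_eq_norm_sq, hζ]
    simp
  -- In this product `f` cancels, so at `ζ` the mass times `m` equals `-2 (1 - re ζ)`; a nonnegative
  -- mass then makes `m` real and negative.
  have hprod : ∀ z, ‖z‖ < 1 → f z / (z - ζ) * ((1 - conj ζ * z) * q z) = conj ζ * (1 - z) ^ 2 := by
    intro z hz
    have h1 : z - ζ ≠ 0 := by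
      rw [← neg_sub]; exact neg_ne_zero.mpr (sub_ne_zero_of_norm_eq_one hζ hz)
    have h2 := hf z hz
    rw [hfq z hz, ← hζζ, ← mul_sub]
    field_simp
    ring
  -- The growth bound keeps the second factor bounded on the radius, so `m = 0` would force `conj ζ
  -- * (1 - ζ) ^ 2 = 0`, contradicting `ζ ≠ 1`.
  have hm0 : m ≠ 0 := by
    rintro rfl
    have hlim := hm.tendsto_path hζ hv
    have hbdd : IsBoundedUnder (· ≤ ·) (𝓝[>] (0 : ℝ)) (norm ∘ fun s : ℝ =>
        (1 - conj ζ * (ζ * (1 - s * 1))) * q (ζ * (1 - s * 1))) := by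
      refine isBoundedUnder_of_eventually_le (a := 5 * ‖q 0‖) ?_
      filter_upwards [eventually_norm_path_lt_one hζ hv, self_mem_nhdsWithin,
        Ioo_mem_nhdsGT (zero_lt_one' ℝ)] with s hs1 hs0 hs2
      have hs0' : 0 < s := hs0
      have h := norm_mul_le_of_re_nonneg hq hpos hs1
      have e1 : ‖ζ * (1 - (s : ℂ) * 1)‖ = 1 - s := by
        rw [norm_mul, hζ, one_mul, mul_one,
          show (1 - s : ℂ) = ((1 - s : ℝ) : ℂ) by push_cast; ring,
          Complex.norm_real, Real.norm_eq_abs, abs_of_pos (by linarith [hs2.2])]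
      rw [e1] at h
      simp only [Function.comp]
      rw [one_sub_conj_mul_path hζ, norm_mul, mul_one, Complex.norm_real, Real.norm_eq_abs,
        abs_of_pos hs0']
      rw [mul_one] at h
      refine le_trans ?_ h
      rw [mul_comm]
      refine mul_le_mul_of_nonneg_left ?_ (norm_nonneg _)
      nlinarith [hs2.2]
    have h0 := hlim.zero_mul_isBoundedUnder_le hbdd
    have hc : Continuous fun s : ℝ => conj ζ * (1 - ζ * (1 - s * 1)) ^ 2 := by fun_prop
    have h1 := (hc.tendsto 0).mono_left (nhdsWithin_le_nhds (s := Ioi (0 : ℝ)))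
    have h2 := tendsto_nhds_unique (h0.congr' (by
      filter_upwards [eventually_norm_path_lt_one hζ hv] with s hs using hprod _ hs)) h1
    simp only [Complex.ofReal_zero, sub_zero, mul_one] at h2
    have h3 : conj ζ ≠ 0 := left_ne_zero_of_mul_eq_one hζζ
    exact mul_ne_zero h3 (pow_ne_zero 2 (sub_ne_zero.mpr hne.symm)) h2.symm
  have hang : HasAngularLimit (fun z => (1 - conj ζ * z) * q z) ζ (conj ζ * (1 - ζ) ^ 2 / m) := by
    intro M hM
    have hc : Continuous fun z : ℂ => conj ζ * (1 - z) ^ 2 := by fun_prop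
    refine (((hc.tendsto ζ).mono_left nhdsWithin_le_nhds).div (hm M hM) hm0).congr' ?_
    filter_upwards [self_mem_nhdsWithin] with z hz
    have h1 : z - ζ ≠ 0 := by
      rw [← neg_sub]; exact neg_ne_zero.mpr (sub_ne_zero_of_norm_eq_one hζ hz.1)
    simp only [Pi.div_apply]
    rw [← hprod z hz.1, mul_div_cancel_left₀ _ (div_ne_zero (hf z hz.1) h1)]
  have hres := angular_residue_nonneg hpos hζ hang
  rw [conj_mul_one_sub_sq hζ] at hres hang
  have hb : 0 < 2 * (1 - ζ.re) := by linarith [re_lt_one_of_norm_eq_one hζ hne]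
  set b : ℝ := 2 * (1 - ζ.re)
  set r : ℝ := (-(b : ℂ) / m).re with hr
  have hreq : -(b : ℂ) / m = (r : ℂ) := Complex.ext (by simp [hr]) (by simpa using hres.1)
  have hr0 : r ≠ 0 := by
    intro h
    rw [h, div_eq_iff hm0] at hreq
    simp [hb.ne'] at hreq
  have hrpos : 0 < r := lt_of_le_of_ne hres.2 hr0.symm
  have hmr : m = ((-(b / r) : ℝ) : ℂ) := by
    rw [div_eq_iff hm0] at hreq
    have : (r : ℂ) ≠ 0 := by exact_mod_cast hr0
    push_cast
    field_simp
    linear_combination -hreq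
  have hbr : 0 < b / r := div_pos hb hrpos
  have hnorm : ‖m‖ = b / r := by
    rw [hmr, Complex.norm_real, Real.norm_eq_abs, abs_neg, abs_of_pos hbr]
  refine ⟨by rw [hmr, Complex.ofReal_im], by rw [hmr, Complex.ofReal_re]; linarith, ?_⟩
  rw [hnorm, div_div_cancel₀ hb.ne', ← hreq]
  exact hang

/-! ### Partial fractions and the conclusion -/

/-- Rests on `1 + ζ^2 = 2 ζ re ζ` on the circle. It matches the extremal terms with Herglotz
kernels, up to an imaginary multiple of `1 / (z - 1)^2` that `c` absorbs. -/
theorem partial_fraction_identity {ζ z : ℂ} (hζ : ‖ζ‖ = 1) (h1 : z - 1 ≠ 0) (h2 : z - ζ ≠ 0) :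
    1 / (z - 1) - 1 / (z - ζ) =
      -(((1 - ζ.re : ℝ) : ℂ) * ((ζ + z) / (ζ - z)) / (z - 1) ^ 2)
        - Complex.I * (ζ.im : ℂ) / (z - 1) ^ 2 := by
  have h3 : ζ - z ≠ 0 := by rw [← neg_sub]; exact neg_ne_zero.mpr h2
  have e : Complex.I * (ζ.im : ℂ) = ζ - ζ.re := by
    linear_combination Complex.re_add_im ζ
  have hre : 1 + ζ ^ 2 - 2 * ζ * ζ.re = 0 := by
    have h4 : conj ζ * ζ = 1 := by
      rw [← Complex.normSq_eq_conj_mul_self, Complex.normSq_eq_norm_sq, hζ]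
      simp
    have h5 := Complex.add_conj ζ
    push_cast at h5
    linear_combination ζ * h5 - h4
  rw [e]
  push_cast
  field_simp
  linear_combination (z - ζ) * hre

theorem corollary4p2 (f : ℂ → ℂ) (hf : IsGeneratorWithDenjoyWolffPoint f 1)
    (N : ℕ) (ζ : Fin N → ℂ) (hinj : Function.Injective ζ) (hne : ∀ n, ζ n ≠ 1)
    (hζ : ∀ n, IsBoundaryRegularNullPoint f (ζ n))
    (m : Fin N → ℂ) (hm : ∀ n, HasAngularDeriv f (ζ n) (m n)) :
    (∀ n, (m n).im = 0 ∧ (m n).re < 0) ∧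
    (∀ z ∈ Metric.ball (0 : ℂ) 1, f z ≠ 0) ∧
    ∑ n, (1 - (ζ n).re) / ‖m n‖ ≤ -(1 / f 0).re ∧
    (∑ n, (1 - (ζ n).re) / ‖m n‖ = -(1 / f 0).re ↔
      ∃ c : ℝ, ∀ z ∈ Metric.ball (0 : ℂ) 1,
        1 / f z = ∑ n, (1 / (‖m n‖ : ℂ)) * (1 / (z - 1) - 1 / (z - ζ n))
          + Complex.I * (c : ℂ) / (z - 1) ^ 2) := by
  obtain ⟨F, hF, hgen, hDW⟩ := hf
  have hf0 : ∀ z, ‖z‖ < 1 → f z ≠ 0 := fun z hz => generator_ne_zero hF hgen hDW hz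
  have hnorm : ∀ n, ‖ζ n‖ = 1 := fun n => (hζ n).1
  have hz1 : ∀ {z : ℂ}, ‖z‖ < 1 → 1 - z ≠ 0 := fun hz => sub_ne_zero_of_norm_eq_one norm_one hz
  set q : ℂ → ℂ := fun z => -(1 - z) ^ 2 / f z with hqdef
  have hqd : DifferentiableOn ℂ q (ball 0 1) :=
    DifferentiableOn.div (by fun_prop) hgen.1 fun z hz => hf0 z (mem_ball_zero_iff.mp hz)
  have hqpos : ∀ z, ‖z‖ < 1 → 0 ≤ (q z).re := by
    intro z hz
    have h := berkson_porta_re_nonneg hF hgen hDW hz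
    have e : q z = (-f z / (1 - z) ^ 2)⁻¹ := by
      simp only [hqdef]
      rw [inv_div, div_neg, neg_div]
    rw [e, Complex.inv_re]
    exact div_nonneg h (Complex.normSq_nonneg _)
  have hm' : ∀ n, HasAngularLimit (fun z => f z / (z - ζ n)) (ζ n) (m n) := by
    intro n
    obtain ⟨w, hw, hd⟩ := hm n
    obtain rfl := hw.unique (hζ n).2.1 (hnorm n)
    simpa using hd
  have hmain := fun n => angular_deriv_neg hf0 hqd hqpos (fun z _ => rfl) (hnorm n) (hne n) (hm' n)
  have hm0 : ∀ n, 0 < ‖m n‖ := fun n => norm_pos_iff.mpr fun h => by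
    have := (hmain n).2.1
    simp [h] at this
  set g : ℂ → ℂ := fun z =>
    q z - ∑ n, (((1 - (ζ n).re) / ‖m n‖ : ℝ) : ℂ) * ((ζ n + z) / (ζ n - z)) with hgdef
  have hgpos : ∀ z, ‖z‖ < 1 → 0 ≤ (g z).re := by
    intro z hz
    have h := re_sub_sum_nonneg hqd hqpos ζ hinj hnorm (fun n => 2 * (1 - (ζ n).re) / ‖m n‖)
      (fun n => div_pos (by linarith [re_lt_one_of_norm_eq_one (hnorm n) (hne n)]) (hm0 n))
      (fun n => (hmain n).2.2) Finset.univ z hz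
    have e : ∀ n, 2 * (1 - (ζ n).re) / ‖m n‖ / 2 = (1 - (ζ n).re) / ‖m n‖ := fun n => by ring
    simp only [e] at h
    exact h
  have hgd : DifferentiableOn ℂ g (ball 0 1) := by
    refine hqd.sub (DifferentiableOn.fun_sum fun n _ => DifferentiableOn.const_mul ?_ _)
    refine DifferentiableOn.div (by fun_prop) (by fun_prop) fun u hu => ?_
    exact sub_ne_zero_of_norm_eq_one (hnorm n) (mem_ball_zero_iff.mp hu)
  -- Each Herglotz kernel equals `1` at the origin, so `re (g 0)` is exactly the defect in the
  -- inequality.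
  have hg0 : (g 0).re = -(1 / f 0).re - ∑ n, (1 - (ζ n).re) / ‖m n‖ := by
    have hζ0 : ∀ n, ζ n ≠ 0 := fun n h => by simpa [h] using hnorm n
    simp only [hgdef, hqdef, Complex.sub_re, Complex.re_sum, add_zero, sub_zero, div_self (hζ0 _),
      mul_one, Complex.ofReal_re, one_pow, neg_div, Complex.neg_re]
  refine ⟨fun n => ⟨(hmain n).1, (hmain n).2.1⟩, fun z hz => hf0 z (mem_ball_zero_iff.mp hz), ?_,
    ?_, ?_⟩
  · linarith [hgpos 0 (by simp)]
  · intro heq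
    -- The sum offsets the imaginary terms of the partial fractions; `-(g 0).im` comes from the
    -- constant `g`, since `1 / f = -q / (z - 1)^2`.
    refine ⟨∑ n, (ζ n).im / ‖m n‖ - (g 0).im, fun z hz => ?_⟩
    rw [mem_ball_zero_iff] at hz
    have hconst := eq_imaginary_const_of_re_zero hgd hgpos (by rw [hg0, heq, sub_self]) hz
    have h1 : z - 1 ≠ 0 := by rw [← neg_sub]; exact neg_ne_zero.mpr (hz1 hz)
    have hterm : ∀ n, (1 / (‖m n‖ : ℂ)) * (1 / (z - 1) - 1 / (z - ζ n)) =
        -((((1 - (ζ n).re) / ‖m n‖ : ℝ) : ℂ) * ((ζ n + z) / (ζ n - z))) / (z - 1) ^ 2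
          - Complex.I * (((ζ n).im / ‖m n‖ : ℝ) : ℂ) / (z - 1) ^ 2 := by
      intro n
      have h2 : z - ζ n ≠ 0 := by
        rw [← neg_sub]; exact neg_ne_zero.mpr (sub_ne_zero_of_norm_eq_one (hnorm n) hz)
      rw [partial_fraction_identity (hnorm n) h1 h2]
      push_cast
      ring
    have hf1 : 1 / f z = -q z / (z - 1) ^ 2 := by
      have := hf0 z hz
      simp only [hqdef]
      rw [show (1 - z) ^ 2 = (z - 1) ^ 2 by ring]
      field_simp
    have hqz : q z = Complex.I * ((g 0).im : ℂ) +
        ∑ n, (((1 - (ζ n).re) / ‖m n‖ : ℝ) : ℂ) * ((ζ n + z) / (ζ n - z)) := by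
      rw [← hconst]
      simp only [hgdef]
      ring
    simp only [hterm]
    rw [hf1, hqz, Finset.sum_sub_distrib, ← Finset.sum_div, ← Finset.sum_div,
      Finset.sum_neg_distrib, ← Finset.mul_sum, Complex.ofReal_sub, Complex.ofReal_sum]
    ring
  · rintro ⟨c, hc⟩
    -- The converse only needs the formula at `z = 0`, where the `c` term is purely imaginary.
    rw [hc 0 (by simp), Complex.add_re, Complex.re_sum, neg_add, ← Finset.sum_neg_distrib]
    have e2 : (Complex.I * (c : ℂ) / (0 - 1) ^ 2).re = 0 := by norm_num
    rw [e2, neg_zero, add_zero]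
    refine Finset.sum_congr rfl fun n _ => ?_
    have h1 : (1 / (0 - ζ n)).re = -(ζ n).re := by
      rw [zero_sub, one_div, Complex.inv_re, Complex.normSq_neg, Complex.normSq_eq_norm_sq, hnorm n]
      simp
    rw [show (1 / (‖m n‖ : ℂ)) = ((1 / ‖m n‖ : ℝ) : ℂ) by push_cast; ring, Complex.re_ofReal_mul,
      Complex.sub_re, h1]
    norm_num
    ring
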